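/- Let $M$ be an oriented matroid on a finite linearly ordered set $E$. For $A\subseteq E$ let $-_AM$ be the oriented matroid obtained from $M$ by reversing the signs of the elements of $A$; the reorientation $-_AM$ of $M$ is identified with the subset $A$, so that $M$ has $2^{|E|}$ reorientations. A circuit or cocircuit is positive if all signs of its elements are positive; below we identify it with its support. Let $a'_1<\dots<a'_\varepsilon$ be the active elements of $M$, i.e. the elements $\min(C)$ for $C$ a positive circuit of $M$, and let $a_1<\dots<a_\iota$ be the dual-active elements of $M$, i.e. the elements $\min(D)$ for $D$ a positive cocircuit of $M$. The active filtration of $M$ is the sequence of subsets $(F'_\varepsilon,\dots,F'_0,F_c,F_0,\dots,F_\iota)$, where $F_c$ is the union of all positive circuits of $M$, $F'_\varepsilon=\emptyset$, $F_\iota=E$, and $$F'_{k}=\bigcup_{\substack{C\text{ positive circuit}\\ \min(C)\ge a'_{k+1}}}C\quad(0\le k<\varepsilon),\qquad F_{k}=E\setminus\bigcup_{\substack{D\text{ positive cocircuit}\\ \min(D)\ge a_{k+1}}}D\quad(0\le k<\iota).$$ The active partition of $M$ consists of the parts $F'_{k-1}\setminus F'_k$ ($1\le k\le\varepsilon$)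 and $F_k\setminus F_{k-1}$ ($1\le k\le\iota$). The activity class of a reorientation $-_AM$ is the set of reorientations obtained from $-_AM$ by reorienting a union of parts of the active partition of $-_AM$. Then the active partition of $M$ is a partition of $E$ into nonempty parts, and reorienting all possible unions of parts of the active partition of $M$ gives exactly $2^{\iota+\varepsilon}$ reorientations of $M$. All of these have the same active filtration and the same active partition as $M$, and hence the same active elements and the same dual-active elements as $M$. Moreover, the activity classes of the reorientations of $M$ form a partition of the set of reorientations of $M$. -/

import Mathlib

/-- Two sign vectors (signed subsets) `X`, `Y` on `E` are orthogonal if their supports are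
disjoint, or if they agree in sign at some element of both supports and disagree in sign at
another one. -/
def SignOrthogonal {E : Type*} (X Y : E → SignType) : Prop :=
  (∀ e, X e * Y e = 0) ∨ ((∃ e, X e * Y e = 1) ∧ ∃ f, X f * Y f = -1)

/-- An oriented matroid with ground set `E` (to be used with `E` finite), given by its signed
circuits. The signed subset `(X⁺, X⁻)` is encoded as the sign vector `X : E → SignType` which is
`1` on `X⁺`, `-1` on `X⁻` and `0` elsewhere. -/
structure OrientedMatroid (E : Type*) where
  /-- The set of signed circuits. -/
  circuits : Set (E → SignType)
  zero_notMem : (0 : E → SignType) ∉ circuits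
  neg_mem : ∀ X ∈ circuits, -X ∈ circuits
  /-- Incomparability. -/
  incomparable : ∀ X ∈ circuits, ∀ Y ∈ circuits,
    Function.support X ⊆ Function.support Y → X = Y ∨ X = -Y
  /-- (Weak) circuit elimination. -/
  elimination : ∀ X ∈ circuits, ∀ Y ∈ circuits, X ≠ -Y → ∀ e, X e = 1 → Y e = -1 →
    ∃ Z ∈ circuits, Z e = 0 ∧ (∀ f, Z f = 1 → X f = 1 ∨ Y f = 1) ∧
      ∀ f, Z f = -1 → X f = -1 ∨ Y f = -1

/-- Change the signs of a sign vector on the elements of `A`. -/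
noncomputable def flipSigns {E : Type*} (A : Set E) (X : E → SignType) : E → SignType := by
  classical exact fun e => if e ∈ A then -X e else X e

theorem flipSigns_of_mem {E : Type*} {A : Set E} {e : E} (h : e ∈ A) (X : E → SignType) :
    flipSigns A X e = -X e := by
  simp [flipSigns, h]

theorem flipSigns_of_notMem {E : Type*} {A : Set E} {e : E} (h : e ∉ A) (X : E → SignType) :
    flipSigns A X e = X e := by
  simp [flipSigns, h]

theorem flipSigns_flipSigns {E : Type*} (A : Set E) (X : E → SignType) :
    flipSigns A (flipSigns A X) = X := by
  funext e
  by_cases h : e ∈ A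
  · rw [flipSigns_of_mem h, flipSigns_of_mem h, neg_neg]
  · rw [flipSigns_of_notMem h, flipSigns_of_notMem h]

theorem flipSigns_neg {E : Type*} (A : Set E) (X : E → SignType) :
    flipSigns A (-X) = -flipSigns A X := by
  funext e
  by_cases h : e ∈ A
  · simp [flipSigns_of_mem h]
  · simp [flipSigns_of_notMem h]

theorem support_flipSigns {E : Type*} (A : Set E) (X : E → SignType) :
    Function.support (flipSigns A X) = Function.support X := by
  ext e
  by_cases h : e ∈ A
  · simp only [Function.mem_support, flipSigns_of_mem h, ne_eq, SignType.neg_eq_zero_iff]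
  · simp only [Function.mem_support, flipSigns_of_notMem h]

namespace OrientedMatroid

/-- The reorientation `-_A M`: the signs of the elements of `A` are reversed in all circuits
(that is, `X` is a circuit of `-_A M` iff `X` with signs reversed on `A` is a circuit of `M`). -/
noncomputable def reorient {E : Type*} (M : OrientedMatroid E) (A : Set E) :
    OrientedMatroid E where
  circuits := {X | flipSigns A X ∈ M.circuits}
  zero_notMem := by
    intro h
    have h0 : flipSigns A (0 : E → SignType) = 0 := by
      funext e
      by_cases he : e ∈ A
      · simp [flipSigns_of_mem he]
      · simp [flipSigns_of_notMem he]
    rw [Set.mem_ofPred_eq, h0] at h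
    exact M.zero_notMem h
  neg_mem := by
    intro X hX
    rw [Set.mem_ofPred_eq, flipSigns_neg]
    exact M.neg_mem _ hX
  incomparable := by
    intro X hX Y hY hXY
    have h := M.incomparable _ hX _ hY (by rwa [support_flipSigns, support_flipSigns])
    rcases h with h | h
    · left
      rw [← flipSigns_flipSigns A X, h, flipSigns_flipSigns]
    · right
      rw [← flipSigns_flipSigns A X, h, flipSigns_neg, flipSigns_flipSigns]
  elimination := by
    intro X hX Y hY hne e hXe hYe
    have hne' : flipSigns A X ≠ -flipSigns A Y := by
      intro h
      apply hne
      rw [← flipSigns_flipSigns A X, h, flipSigns_neg, flipSigns_flipSigns]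
    have key : ∃ Z ∈ M.circuits, Z e = 0 ∧
        (∀ f, Z f = 1 → flipSigns A X f = 1 ∨ flipSigns A Y f = 1) ∧
        ∀ f, Z f = -1 → flipSigns A X f = -1 ∨ flipSigns A Y f = -1 := by
      by_cases he : e ∈ A
      · have hne'' : flipSigns A Y ≠ -flipSigns A X := by
          intro h
          apply hne'
          rw [h, neg_neg]
        obtain ⟨Z, hZ, h0, h1, h2⟩ := M.elimination _ hY _ hX hne'' e
          (by rw [flipSigns_of_mem he, hYe]; rfl) (by rw [flipSigns_of_mem he, hXe])
        exact ⟨Z, hZ, h0, fun f hf => (h1 f hf).symm, fun f hf => (h2 f hf).symm⟩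
      · exact M.elimination _ hX _ hY hne' e
          (by rw [flipSigns_of_notMem he, hXe]) (by rw [flipSigns_of_notMem he, hYe])
    obtain ⟨Z, hZ, h0, h1, h2⟩ := key
    refine ⟨flipSigns A Z, ?_, ?_, ?_, ?_⟩
    · rw [Set.mem_ofPred_eq, flipSigns_flipSigns]
      exact hZ
    · by_cases he : e ∈ A
      · simp [flipSigns_of_mem he, h0]
      · simp [flipSigns_of_notMem he, h0]
    · intro f hf
      by_cases hfA : f ∈ A
      · rw [flipSigns_of_mem hfA, neg_eq_iff_eq_neg] at hf
        simpa [flipSigns_of_mem hfA] using h2 f hf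
      · rw [flipSigns_of_notMem hfA] at hf
        simpa [flipSigns_of_notMem hfA] using h1 f hf
    · intro f hf
      by_cases hfA : f ∈ A
      · rw [flipSigns_of_mem hfA, neg_inj] at hf
        have := h1 f hf
        rw [flipSigns_of_mem hfA, flipSigns_of_mem hfA] at this
        rcases this with h | h
        · left; rw [← h, neg_neg]
        · right; rw [← h, neg_neg]
      · rw [flipSigns_of_notMem hfA] at hf
        simpa [flipSigns_of_notMem hfA] using h2 f hf

/-- The signed cocircuits of `M`: the sign vectors of inclusion-minimal support among the nonzero
sign vectors orthogonal to all circuits of `M`. -/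
def cocircuits {E : Type*} (M : OrientedMatroid E) : Set (E → SignType) :=
  {Y | Y ≠ 0 ∧ (∀ X ∈ M.circuits, SignOrthogonal X Y) ∧
    ∀ Z : E → SignType, Z ≠ 0 → (∀ X ∈ M.circuits, SignOrthogonal X Z) →
      Function.support Z ⊆ Function.support Y → Function.support Z = Function.support Y}

/-- `C` is (the support of) a positive circuit of `M`. -/
def IsPositiveCircuit {E : Type*} (M : OrientedMatroid E) (C : Set E) : Prop :=
  ∃ X ∈ M.circuits, (∀ e, 0 ≤ X e) ∧ Function.support X = C

/-- `D` is (the support of) a positive cocircuit of `M`. -/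
def IsPositiveCocircuit {E : Type*} (M : OrientedMatroid E) (D : Set E) : Prop :=
  ∃ Y ∈ M.cocircuits, (∀ e, 0 ≤ Y e) ∧ Function.support Y = D

/-- `O(M)`, the set of active elements: the minima of the positive circuits. -/
def activeElements {E : Type*} [LinearOrder E] (M : OrientedMatroid E) : Set E :=
  {a | ∃ C, M.IsPositiveCircuit C ∧ IsLeast C a}

/-- `O*(M)`, the set of dual-active elements: the minima of the positive cocircuits. -/
def dualActiveElements {E : Type*} [LinearOrder E] (M : OrientedMatroid E) : Set E :=
  {a | ∃ D, M.IsPositiveCocircuit D ∧ IsLeast D a}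

/-- The union of the positive circuits of `M` all of whose elements are `≥ a`. -/
def circuitUnionGE {E : Type*} [LinearOrder E] (M : OrientedMatroid E) (a : E) : Set E :=
  ⋃₀ {C | M.IsPositiveCircuit C ∧ ∀ e ∈ C, a ≤ e}

/-- The union of the positive cocircuits of `M` all of whose elements are `≥ a`. -/
def cocircuitUnionGE {E : Type*} [LinearOrder E] (M : OrientedMatroid E) (a : E) : Set E :=
  ⋃₀ {D | M.IsPositiveCocircuit D ∧ ∀ e ∈ D, a ≤ e}

end OrientedMatroid

/-- The elements of a set in a finite linear order, listed in increasing order. -/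
noncomputable def sortedElements {E : Type*} [Fintype E] [LinearOrder E] (S : Set E) : List E :=
  S.toFinite.toFinset.sort (· ≤ ·)

/-- The data of a sequence of subsets `(F'_ε, …, F'_0, F_c, F_0, …, F_ι)` of `E`. -/
@[ext]
structure FiltrationData (E : Type*) where
  /-- The list `F'_0, F'_1, …, F'_ε`. -/
  lower : List (Set E)
  /-- The set `F_c`. -/
  cyclicFlat : Set E
  /-- The list `F_0, F_1, …, F_ι`. -/
  upper : List (Set E)

namespace OrientedMatroid

/-- The active filtration of an ordered oriented matroid. With active elements
`a'_1 < … < a'_ε` and dual-active elements `a_1 < … < a_ι`: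
`F'_{k-1}` is the union of the positive circuits with minimum `≥ a'_k`, and `F'_ε = ∅`;
`F_c` is the union of all positive circuits;
`F_{k-1}` is the complement of the union of the positive cocircuits with minimum `≥ a_k`, and
`F_ι = E`. -/
noncomputable def activeFiltration {E : Type*} [Fintype E] [LinearOrder E]
    (M : OrientedMatroid E) : FiltrationData E where
  lower := (sortedElements M.activeElements).map (fun a => M.circuitUnionGE a) ++ [∅]
  cyclicFlat := ⋃₀ {C | M.IsPositiveCircuit C}
  upper := (sortedElements M.dualActiveElements).map (fun a => (M.cocircuitUnionGE a)ᶜ) ++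
    [Set.univ]

/-- The active partition of an ordered oriented matroid, as the set of its parts, which are the
successive differences `F'_{k-1} \ F'_k` (`1 ≤ k ≤ ε`) and `F_k \ F_{k-1}` (`1 ≤ k ≤ ι`) of the
active filtration. -/
def activePartition {E : Type*} [Fintype E] [LinearOrder E] (M : OrientedMatroid E) :
    Set (Set E) :=
  {P | (∃ (k : ℕ) (F G : Set E), M.activeFiltration.lower[k]? = some F ∧
          M.activeFiltration.lower[k + 1]? = some G ∧ P = F \ G) ∨
       (∃ (k : ℕ) (F G : Set E), M.activeFiltration.upper[k]? = some F ∧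
          M.activeFiltration.upper[k + 1]? = some G ∧ P = G \ F)}

/-- The unions of parts of the active partition of `M`. -/
def activeUnions {E : Type*} [Fintype E] [LinearOrder E] (M : OrientedMatroid E) : Set (Set E) :=
  {A | ∃ S ⊆ M.activePartition, A = ⋃₀ S}

/-- A reorientation `-_A M` of `M` is identified with the subset `A`. The activity class of the
reorientation `-_A M` is the set of reorientations of `M` obtained by reorienting, in `-_A M`, a
union `B` of parts of the active partition of `-_A M`; reorienting `B` in `-_A M` gives the
reorientation of `M` identified with the symmetric difference of `A` and `B`. -/
def activityClass {E : Type*} [Fintype E] [LinearOrder E] (M : OrientedMatroid E) (A : Set E) :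
    Set (Set E) :=
  {A' | ∃ B ∈ (M.reorient A).activeUnions, A' = symmDiff A B}

end OrientedMatroid

/-!
Paint the ground set so that no circuit compatible with the painting is positive at `e`, and make
the painting maximal. By strong elimination every element is then painted, and the sign vector of
the painting is orthogonal to all circuits. Hence every element lies in a positive circuit or in a
positive cocircuit, and the support of a nonnegative vector (covector) is the union of the positive
circuits (cocircuits) inside it. Thus circuits may be replaced by vectors, and the supports of
nonnegative vectors are closed under unions because vectors can be composed.

Let `U` be the union of the positive circuits with minimum at least `a`. It is the support of a
nonnegative vector, hence disjoint from every positive cocircuit, so that reorienting `U` keeps the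
positive cocircuits. Composing the vector of `U` with a nonnegative vector of the reorientation
gives, up to the signs on `U`, a nonnegative vector of `M`, so for every `b` the union of the
positive circuits with minimum at least `b` is unchanged as well. Dually for cocircuits. Every part
of the active partition is such a union or the symmetric difference of two of them, so reorienting
parts never changes the filtration.
-/

/-! ### Strong circuit elimination -/

theorem SignOrthogonal.symm {E : Type*} {X Y : E → SignType} (h : SignOrthogonal X Y) :
    SignOrthogonal Y X := by
  simpa only [SignOrthogonal, mul_comm] using h

theorem SignOrthogonal.exists_mul_eq_neg_one {E : Type*} {X Y : E → SignType}
    (h : SignOrthogonal X Y) {e : E} (he : X e * Y e = 1) : ∃ f, X f * Y f = -1 := by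
  rcases h with h | h
  · simp [h e] at he
  · exact h.2

theorem sign_eq_one_of_nonneg {s : SignType} (hs : 0 ≤ s) (hs0 : s ≠ 0) : s = 1 := by
  decide +revert

theorem sign_eq_of_mul_eq_neg_one {s t : SignType} (ht : 0 ≤ t) (h : s * t = -1) :
    s = -1 ∧ t = 1 := by
  decide +revert

/-- Every sign of `Z` is zero or is inherited from `X` or from `Y`, as in circuit elimination. -/
def SignBetween {E : Type*} (X Y Z : E → SignType) : Prop :=
  ∀ h, Z h = 0 ∨ Z h = X h ∨ Z h = Y h

theorem signBetween_iff {E : Type*} {X Y Z : E → SignType} :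
    SignBetween X Y Z ↔
      (∀ h, Z h = 1 → X h = 1 ∨ Y h = 1) ∧ ∀ h, Z h = -1 → X h = -1 ∨ Y h = -1 := by
  have pointwise : ∀ x y z : SignType,
      (z = 0 ∨ z = x ∨ z = y) ↔ (z = 1 → x = 1 ∨ y = 1) ∧ (z = -1 → x = -1 ∨ y = -1) := by
    decide
  rw [← forall_and]
  exact forall_congr' fun h => pointwise (X h) (Y h) (Z h)

theorem SignBetween.symm {E : Type*} {X Y Z : E → SignType} (h : SignBetween X Y Z) :
    SignBetween Y X Z :=
  fun e => (h e).imp_right Or.symm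

theorem support_union_ssubset {E α : Type*} [Zero α] {X Y X' Y' : E → α} {e : E}
    (he : X e ≠ 0 ∨ Y e ≠ 0) (hX'e : X' e = 0) (hY'e : Y' e = 0)
    (hsub : ∀ h, X h = 0 → Y h = 0 → X' h = 0 ∧ Y' h = 0) :
    Function.support X' ∪ Function.support Y' ⊂ Function.support X ∪ Function.support Y := by
  refine (Set.ssubset_iff_of_subset fun h hh => ?_).2 ⟨e, he, by simp [hX'e, hY'e]⟩
  by_contra hc
  simp only [Set.mem_union, Function.mem_support, not_or, not_not] at hh hc
  simp [hsub h hc.1 hc.2] at hh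

namespace OrientedMatroid

section Elimination

variable {E : Type*} (M : OrientedMatroid E)

theorem weak_elimination {X Y : E → SignType} (hX : X ∈ M.circuits) (hY : Y ∈ M.circuits)
    (hXY : X ≠ -Y) {k : E} (hk : X k = -Y k) (hk0 : X k ≠ 0) :
    ∃ Z ∈ M.circuits, Z k = 0 ∧ SignBetween X Y Z := by
  wlog hXk : X k = 1 generalizing X Y
  · have hYk : Y k = 1 := by generalize X k = x, Y k = y at *; decide +revert
    obtain ⟨Z, hZ, hZk, hb⟩ := this hY hX (fun h => hXY (by rw [h, neg_neg]))
      (by rw [hk, neg_neg]) (by simp [hYk]) hYk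
    exact ⟨Z, hZ, hZk, hb.symm⟩
  · obtain ⟨Z, hZ, hZk, hb⟩ := M.elimination X hX Y hY hXY k hXk (by rw [← hXk, hk, neg_neg])
    exact ⟨Z, hZ, hZk, signBetween_iff.2 hb⟩

theorem exists_notMem_support {X Z : E → SignType} (hX : X ∈ M.circuits)
    (hZ : Z ∈ M.circuits) {k : E} (hXk : X k ≠ 0) (hZk : Z k = 0) : ∃ g, Z g ≠ 0 ∧ X g = 0 := by
  by_contra! hc
  rcases M.incomparable Z hZ X hX hc with rfl | rfl
  · exact hXk hZk
  · exact hXk (SignType.neg_eq_zero_iff.1 hZk)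

/-- Strong elimination for `X` and `Y`: some circuit with signs inherited from `X` and `Y` vanishes
at `k` and agrees with `X` at `f`. -/
def CanEliminate (X Y : E → SignType) (k f : E) : Prop :=
  ∃ Z ∈ M.circuits, Z k = 0 ∧ Z f = X f ∧ SignBetween X Y Z

theorem canEliminate_or_exists_circuit_eq_zero {X Y : E → SignType} {k f : E}
    (hX : X ∈ M.circuits) (hY : Y ∈ M.circuits) (hk : X k = -Y k) (hk0 : X k ≠ 0) (hf : X f ≠ 0)
    (hXYf : X f ≠ -Y f) :
    M.CanEliminate X Y k f ∨ ∃ D ∈ M.circuits, D k = 0 ∧ D f = 0 ∧ SignBetween X Y D ∧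
      ∃ g, X g = 0 ∧ Y g ≠ 0 ∧ D g = Y g := by
  obtain ⟨D, hD, hDk, hDb⟩ := M.weak_elimination hX hY (fun h => hXYf (by simp [h])) hk hk0
  by_cases hDf : D f = 0
  · obtain ⟨g, hDg, hXg⟩ := M.exists_notMem_support hX hD hk0 hDk
    have hDgY : D g = Y g := by grind [hDb g]
    exact Or.inr ⟨D, hD, hDk, hDf, hDb, g, hXg, hDgY ▸ hDg, hDgY⟩
  · refine Or.inl ⟨D, hD, hDk, ?_, hDb⟩
    have := hDb f
    generalize X f = x, Y f = y, D f = d at *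
    decide +revert

theorem exists_circuit_conformal [Finite E] {W D : E → SignType} {f : E} (hW : W ∈ M.circuits)
    (elim : ∀ V ∈ M.circuits, SignBetween W D V → V f = W f → ∀ h, V h = -D h → V h ≠ 0 →
      M.CanEliminate V D h f) :
    ∃ Z ∈ M.circuits, Z f = W f ∧ SignBetween W D Z ∧ ∀ h, Z h = -D h → Z h = 0 := by
  obtain ⟨Z, ⟨hZ, hZf, hZb⟩, hmin⟩ := Set.Finite.exists_minimalFor
    (fun V : E → SignType => {h | V h = -D h ∧ V h ≠ 0})
    {V | V ∈ M.circuits ∧ V f = W f ∧ SignBetween W D V} (Set.toFinite _)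
    ⟨W, hW, rfl, fun _ => Or.inr (Or.inl rfl)⟩
  refine ⟨Z, hZ, hZf, hZb, fun h hh => ?_⟩
  by_contra hZh
  obtain ⟨V, hV, hVh, hVf, hVb⟩ := elim Z hZ hZb hZf h hh hZh
  have hsub : {j | V j = -D j ∧ V j ≠ 0} ⊆ {j | Z j = -D j ∧ Z j ≠ 0} := by
    rintro j ⟨hj, hj0⟩
    have := hVb j
    simp only [Set.mem_ofPred_eq]
    generalize V j = v, Z j = z, D j = d at *
    decide +revert
  exact (hmin ⟨hV, hVf.trans hZf, fun j => by grind [hVb j, hZb j]⟩ hsub ⟨hh, hZh⟩).2 hVh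

/-- The signs which a circuit `W` inherits from `-D` can be removed by eliminations with `D`. -/
theorem canEliminate_of_circuit [Finite E] {X Y D W : E → SignType} {k f : E} (hDk : D k = 0)
    (hDb : SignBetween X Y D) (hW : W ∈ M.circuits) (hWk : W k = 0) (hWf : W f = X f)
    (hWb : ∀ h, W h = 0 ∨ W h = X h ∨ W h = Y h ∨ W h = -D h)
    (elim : ∀ V ∈ M.circuits, SignBetween W D V → V f = W f → ∀ h, V h = -D h → V h ≠ 0 →
      M.CanEliminate V D h f) :
    M.CanEliminate X Y k f := by
  obtain ⟨Z, hZ, hZf, hZb, hZD⟩ := M.exists_circuit_conformal hW elim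
  exact ⟨Z, hZ, by grind [hZb k], hZf.trans hWf,
    fun h => by grind [hZb h, hZD h, hWb h, hDb h]⟩

/-- If weak elimination yields a circuit `D` that vanishes at `f`, eliminate some `g` between `Y`
and `-D`: the resulting circuit `Y'` can replace `Y`, with a smaller union of supports, at the price
of signs inherited from `-D`, which are removed afterwards. -/
theorem canEliminate_of_eq_zero [Finite E] {X Y : E → SignType} (hX : X ∈ M.circuits)
    (hY : Y ∈ M.circuits) {k f : E} (hk : X k = -Y k) (hk0 : X k ≠ 0) (hf : X f ≠ 0)
    (hYf : Y f = 0) : M.CanEliminate X Y k f := by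
  induction hS : Function.support X ∪ Function.support Y using WellFoundedLT.induction
    generalizing X Y k f with | ind S ih
  subst hS
  have hYk : Y k ≠ 0 := fun h => hk0 (by rw [hk, h, neg_zero])
  rcases M.canEliminate_or_exists_circuit_eq_zero hX hY hk hk0 hf (by rwa [hYf, neg_zero]) with
    h | ⟨D, hD, hDk, hDf, hDb, g, hXg, hYg, hDg⟩
  · exact h
  have hD0 : ∀ h, X h = 0 → Y h = 0 → D h = 0 := fun h h1 h2 => by simpa [h1, h2] using hDb h
  obtain ⟨Y', hY', hY'g, hY'k, hY'b⟩ := ih _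
    (support_union_ssubset (Or.inl hf) hYf (by simp [hDf]) fun h h1 h2 =>
      ⟨h2, by simp [hD0 h h1 h2]⟩)
    hY (M.neg_mem D hD) (k := g) (f := k) (by simp [hDg]) hYg hYk (by simp [hDk]) rfl
  have hY'0 : ∀ h, Y h = 0 → D h = 0 → Y' h = 0 := fun h h1 h2 => by simpa [h1, h2] using hY'b h
  obtain ⟨W, hW, hWk, hWf, hWb⟩ := ih _
    (support_union_ssubset (Or.inr hYg) hXg hY'g fun h h1 h2 => ⟨h1, hY'0 h h2 (hD0 h h1 h2)⟩)
    hX hY' (k := k) (f := f) (by rw [hk, hY'k]) hk0 hf (hY'0 f hYf hDf) rfl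
  refine M.canEliminate_of_circuit hDk hDb hW hWk hWf
    (fun h => by grind [hWb h, hY'b h, Pi.neg_apply]) fun V hV hVb hVf h hh hh0 => ?_
  refine ih _ (support_union_ssubset (Or.inl hk0) ?_ hDk fun j h1 h2 => ⟨?_, hD0 j h1 h2⟩)
    hV hD hh hh0 (by rwa [hVf, hWf]) hDf rfl
  · simpa [hWk, hDk] using hVb k
  · have hW0 : W j = 0 := by simpa [h1, hY'0 j h2 (hD0 j h1 h2)] using hWb j
    simpa [hW0, hD0 j h1 h2] using hVb j

theorem strong_elimination [Finite E] {X Y : E → SignType} (hX : X ∈ M.circuits)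
    (hY : Y ∈ M.circuits) {k f : E} (hk : X k = -Y k) (hk0 : X k ≠ 0) (hf : X f ≠ 0)
    (hXYf : X f ≠ -Y f) : M.CanEliminate X Y k f := by
  induction hS : Function.support X ∪ Function.support Y using WellFoundedLT.induction
    generalizing X Y with | ind S ih
  subst hS
  by_cases hYf0 : Y f = 0
  · exact M.canEliminate_of_eq_zero hX hY hk hk0 hf hYf0
  have hXf : Y f = X f := by generalize X f = x, Y f = y at *; decide +revert
  rcases M.canEliminate_or_exists_circuit_eq_zero hX hY hk hk0 hf hXYf with
    h | ⟨D, hD, hDk, hDf, hDb, g, hXg, hYg, hDg⟩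
  · exact h
  obtain ⟨Y', hY', hY'g, hY'f, hY'b⟩ := M.canEliminate_of_eq_zero
    hY (M.neg_mem D hD) (k := g) (f := f) (by simp [hDg]) hYg hYf0 (by simp [hDf])
  have repair : ∀ W ∈ M.circuits, W k = 0 → W f = X f → SignBetween X Y' W →
      M.CanEliminate X Y k f := fun W hW hWk hWf hWb =>
    M.canEliminate_of_circuit hDk hDb hW hWk hWf
      (fun h => by grind [hWb h, hY'b h, Pi.neg_apply]) fun V hV _ hVf h hh hh0 =>
        M.canEliminate_of_eq_zero hV hD hh hh0 (by rwa [hVf, hWf]) hDf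
  by_cases hY'k : Y' k = 0
  · exact repair Y' hY' hY'k (hY'f.trans hXf) fun _ => Or.inr (Or.inr rfl)
  have hY'kY : Y' k = Y k := by simpa [hY'k, hDk] using hY'b k
  obtain ⟨W, hW, hWk, hWf, hWb⟩ := ih _
    (support_union_ssubset (Or.inr hYg) hXg hY'g fun h h1 h2 =>
      ⟨h1, by grind [hDb h, hY'b h, neg_zero, Pi.neg_apply]⟩)
    hX hY' (by rw [hk, hY'kY]) hk0 hf (by rwa [hY'f]) rfl
  exact repair W hW hWk hWf hWb

end Elimination

end OrientedMatroid

/-! ### Painting the ground set -/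

/-- The signs of `X` are compatible with the partial painting of the ground set in which positive
elements must lie in `P` and negative ones in `N`; the sets `P` and `N` may overlap. -/
def SignsIn {E : Type*} (P N : Set E) (X : E → SignType) : Prop :=
  (∀ h, X h = 1 → h ∈ P) ∧ ∀ h, X h = -1 → h ∈ N

theorem SignsIn.mono {E : Type*} {P P' N N' : Set E} {X : E → SignType} (h : SignsIn P N X)
    (hP : P ⊆ P') (hN : N ⊆ N') : SignsIn P' N' X :=
  ⟨fun g hg => hP (h.1 g hg), fun g hg => hN (h.2 g hg)⟩

theorem SignsIn.of_signBetween {E : Type*} {P N : Set E} {X Y Z : E → SignType} {k : E}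
    (hX : SignsIn (insert k P) (insert k N) X) (hY : SignsIn (insert k P) (insert k N) Y)
    (hZ : SignBetween X Y Z) (hZk : Z k = 0) : SignsIn P N Z := by
  obtain ⟨hpos, hneg⟩ := signBetween_iff.1 hZ
  constructor
  · intro h hh
    have hhk : h ≠ k := by rintro rfl; simp [hZk] at hh
    exact ((hpos h hh).elim (hX.1 h) (hY.1 h)).resolve_left hhk
  · intro h hh
    have hhk : h ≠ k := by rintro rfl; simp [hZk] at hh
    exact ((hneg h hh).elim (hX.2 h) (hY.2 h)).resolve_left hhk

open Classical in
/-- The sign vector obtained from a painting `P ∪ N` of the ground set: zero on the overlap of `P`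
and `N`, positive on the rest of `P` and negative on the rest of `N`. -/
noncomputable def paintSign {E : Type*} (P N : Set E) : E → SignType :=
  fun h => if h ∈ P then if h ∈ N then 0 else 1 else -1

theorem signsIn_of_mul_paintSign_ne {E : Type*} {P N : Set E} (hPN : P ∪ N = Set.univ)
    {X : E → SignType} (hX : ∀ h, X h * paintSign P N h ≠ -1) : SignsIn P N X := by
  constructor
  · intro h hh
    by_contra hP
    exact hX h (by simp [paintSign, hh, hP])
  · intro h hh
    by_contra hN
    have hP : h ∈ P := (hPN.ge (Set.mem_univ h)).resolve_right hN
    exact hX h (by simp [paintSign, hh, hP, hN])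

namespace OrientedMatroid

section Painting

variable {E : Type*} (M : OrientedMatroid E)

/-- No circuit compatible with the painting `P`, `N` is positive at `e ∈ P \ N`. -/
def Blocks (e : E) (P N : Set E) : Prop :=
  e ∈ P ∧ e ∉ N ∧ ∀ X ∈ M.circuits, SignsIn P N X → X e ≠ 1

variable {M} {e k : E} {P N : Set E}

theorem Blocks.false_of_opposite [Finite E] (hB : M.Blocks e P N) {X Y : E → SignType}
    (hX : X ∈ M.circuits) (hXs : SignsIn (insert k P) (insert k N) X) (hY : Y ∈ M.circuits)
    (hYs : SignsIn (insert k P) (insert k N) Y) (hk : X k = -Y k) (hk0 : X k ≠ 0)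
    (hXe : X e = 1) (hYe : Y e ≠ -1) : False := by
  obtain ⟨Z, hZ, hZk, hZe, hZb⟩ := M.strong_elimination hX hY hk hk0 (f := e) (by simp [hXe])
    (by rwa [hXe, ne_eq, eq_comm, neg_eq_iff_eq_neg])
  exact hB.2.2 Z hZ (hXs.of_signBetween hYs hZb hZk) (hZe.trans hXe)

theorem Blocks.exists_of_not_insert_left (hB : M.Blocks e P N)
    (hk : ¬M.Blocks e (insert k P) N) :
    ∃ X ∈ M.circuits, SignsIn (insert k P) N X ∧ X e = 1 ∧ X k = 1 := by
  obtain ⟨he, heN, hB⟩ := hB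
  simp only [Blocks, he, heN, Set.mem_insert_of_mem, not_false_eq_true, true_and, not_forall,
    not_not] at hk
  obtain ⟨X, hX, hXs, hXe⟩ := hk
  refine ⟨X, hX, hXs, hXe, by_contra fun hXk => hB X hX ⟨fun h hh => ?_, hXs.2⟩ hXe⟩
  exact (hXs.1 h hh).resolve_left fun hhk => hXk (hhk ▸ hh)

theorem Blocks.exists_of_not_insert_right (hB : M.Blocks e P N) (hke : k ≠ e)
    (hk : ¬M.Blocks e P (insert k N)) :
    ∃ X ∈ M.circuits, SignsIn P (insert k N) X ∧ X e = 1 ∧ X k = -1 := by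
  obtain ⟨he, heN, hB⟩ := hB
  simp only [Blocks, he, heN, Set.mem_insert_iff, hke.symm, or_self, not_false_eq_true, true_and,
    not_forall, not_not] at hk
  obtain ⟨X, hX, hXs, hXe⟩ := hk
  refine ⟨X, hX, hXs, hXe, by_contra fun hXk => hB X hX ⟨hXs.1, fun h hh => ?_⟩ hXe⟩
  exact (hXs.2 h hh).resolve_left fun hhk => hXk (hhk ▸ hh)

theorem Blocks.insert_left_or_insert_right [Finite E] (hB : M.Blocks e P N) (hke : k ≠ e) :
    M.Blocks e (insert k P) N ∨ M.Blocks e P (insert k N) := by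
  by_contra! hc
  obtain ⟨X, hX, hXs, hXe, hXk⟩ := hB.exists_of_not_insert_left hc.1
  obtain ⟨Y, hY, hYs, hYe, hYk⟩ := hB.exists_of_not_insert_right hke hc.2
  exact hB.false_of_opposite hX (hXs.mono subset_rfl (Set.subset_insert k N)) hY
    (hYs.mono (Set.subset_insert k P) subset_rfl) (by rw [hXk, hYk, neg_neg]) (by simp [hXk]) hXe
    (by simp [hYe])

variable (M) in
/-- A painting `P`, `N` that blocks `e` and admits no larger one. -/
def MaximalBlocks (e : E) (P N : Set E) : Prop :=
  Maximal (fun p : Set E × Set E => M.Blocks e p.1 p.2) (P, N)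

theorem MaximalBlocks.mem_left_of_blocks (hm : M.MaximalBlocks e P N)
    (hk : M.Blocks e (insert k P) N) : k ∈ P :=
  (hm.2 (y := (insert k P, N)) hk ⟨Set.subset_insert k P, le_rfl⟩).1 (Set.mem_insert k P)

theorem MaximalBlocks.mem_right_of_blocks (hm : M.MaximalBlocks e P N)
    (hk : M.Blocks e P (insert k N)) : k ∈ N :=
  (hm.2 (y := (P, insert k N)) hk ⟨le_rfl, Set.subset_insert k N⟩).2 (Set.mem_insert k N)

theorem MaximalBlocks.union_eq_univ [Finite E] (hm : M.MaximalBlocks e P N) :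
    P ∪ N = Set.univ := by
  refine Set.eq_univ_of_forall fun k => ?_
  rcases eq_or_ne k e with rfl | hke
  · exact Or.inl hm.prop.1
  · exact (hm.prop.insert_left_or_insert_right hke).imp hm.mem_left_of_blocks
      hm.mem_right_of_blocks

theorem MaximalBlocks.exists_mul_paintSign_eq_neg_one [Finite E] (hm : M.MaximalBlocks e P N)
    {X : E → SignType} (hX : X ∈ M.circuits) (hk : X k * paintSign P N k = 1) :
    ∃ f, X f * paintSign P N f = -1 := by
  by_contra! hc
  have hB : M.Blocks e P N := hm.prop
  have hXs := signsIn_of_mul_paintSign_ne hm.union_eq_univ hc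
  have hXe' : X e ≠ -1 := fun h => hB.2.1 (hXs.2 e h)
  have hXs' := hXs.mono (Set.subset_insert k P) (Set.subset_insert k N)
  have hke : k ≠ e := by
    rintro rfl
    exact hB.2.2 X hX hXs (by simpa [paintSign, hB.1, hB.2.1] using hk)
  by_cases hP : k ∈ P
  · have hN : k ∉ N := fun hN => by simp [paintSign, hP, hN] at hk
    have hXk : X k = 1 := by simpa [paintSign, hP, hN] using hk
    obtain ⟨X', hX', hX's, hX'e, hX'k⟩ :=
      hB.exists_of_not_insert_right hke (mt hm.mem_right_of_blocks hN)
    exact hB.false_of_opposite hX' (hX's.mono (Set.subset_insert k P) subset_rfl) hX hXs'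
      (by rw [hX'k, hXk]) (by simp [hX'k]) hX'e hXe'
  · have hXk : X k = -1 := by simpa [paintSign, hP, neg_eq_iff_eq_neg] using hk
    obtain ⟨X', hX', hX's, hX'e, hX'k⟩ :=
      hB.exists_of_not_insert_left (mt hm.mem_left_of_blocks hP)
    exact hB.false_of_opposite hX' (hX's.mono subset_rfl (Set.subset_insert k N)) hX hXs'
      (by rw [hX'k, hXk, neg_neg]) (by simp [hX'k]) hX'e hXe'

end Painting

end OrientedMatroid

/-! ### Vectors and covectors -/

/-- The orthogonal complement of a set of sign vectors. -/
def signPerp {E : Type*} (V : Set (E → SignType)) : Set (E → SignType) :=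
  {Y | ∀ X ∈ V, SignOrthogonal X Y}

open Classical in
/-- The composition `X ∘ Y` of sign vectors: the signs of `X`, completed by those of `Y`. -/
noncomputable def signComp {E : Type*} (X Y : E → SignType) : E → SignType :=
  fun h => if X h = 0 then Y h else X h

/-- The supports of the nonnegative members of a set of sign vectors. -/
def positiveSupports {E : Type*} (V : Set (E → SignType)) : Set (Set E) :=
  {S | ∃ X ∈ V, (∀ e, 0 ≤ X e) ∧ Function.support X = S}

section SignPerp

variable {E : Type*} {V : Set (E → SignType)} {X Y : E → SignType}

theorem signOrthogonal_of_forall (hneg : ∀ X ∈ V, -X ∈ V)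
    (hY : ∀ X ∈ V, ∀ k, X k * Y k = 1 → ∃ f, X f * Y f = -1) (hX : X ∈ V) :
    SignOrthogonal X Y := by
  by_contra hc
  simp only [SignOrthogonal, not_or, not_forall] at hc
  obtain ⟨⟨k, hk⟩, hne⟩ := hc
  have hk' : X k * Y k = 1 ∨ X k * Y k = -1 := by
    generalize X k * Y k = s at *
    decide +revert
  rcases hk' with h | h
  · exact hne ⟨⟨k, h⟩, hY X hX k h⟩
  · obtain ⟨f, hf⟩ := hY (-X) (hneg X hX) k (by simp [h])
    exact hne ⟨⟨f, by simpa [neg_eq_iff_eq_neg] using hf⟩, k, h⟩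

theorem neg_mem_signPerp (hY : Y ∈ signPerp V) : -Y ∈ signPerp V := by
  intro X hX
  rcases hY X hX with h | ⟨⟨e, he⟩, f, hf⟩
  · exact Or.inl fun e => by simp [h e]
  · exact Or.inr ⟨⟨f, by simp [hf]⟩, e, by simp [he]⟩

theorem exists_mem_signPerp_eq (hY : Y ∈ signPerp V) {e : E} (he : Y e ≠ 0) {s : SignType}
    (hs : s ≠ 0) : ∃ Z ∈ signPerp V, Z e = s ∧ Function.support Z = Function.support Y := by
  by_cases hYs : Y e = s
  · exact ⟨Y, hY, hYs, rfl⟩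
  · refine ⟨-Y, neg_mem_signPerp hY, ?_, by ext; simp⟩
    rw [Pi.neg_apply]
    generalize Y e = y at *
    decide +revert

theorem zero_mem_signPerp : (0 : E → SignType) ∈ signPerp V :=
  fun _ _ => Or.inl fun _ => mul_zero _

theorem signComp_mem_signPerp {Z : E → SignType} (hY : Y ∈ signPerp V) (hZ : Z ∈ signPerp V) :
    signComp Y Z ∈ signPerp V := by
  intro X hX
  rcases hY X hX with h | ⟨⟨e, he⟩, f, hf⟩
  · have hXYZ : ∀ e, X e * signComp Y Z e = X e * Z e := fun e => by
      by_cases hYe : Y e = 0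
      · simp [signComp, hYe]
      · simp [(mul_eq_zero.1 (h e)).resolve_right hYe]
    simpa only [SignOrthogonal, hXYZ] using hZ X hX
  · have hcomp : ∀ e, X e * Y e ≠ 0 → X e * signComp Y Z e = X e * Y e := fun e h => by
      simp [signComp, right_ne_zero_of_mul h]
    exact Or.inr ⟨⟨e, by rw [hcomp e (by simp [he]), he]⟩, f, by rw [hcomp f (by simp [hf]), hf]⟩

theorem support_signComp : Function.support (signComp X Y) =
    Function.support X ∪ Function.support Y := by
  ext e
  by_cases h : X e = 0 <;> simp [signComp, h]

theorem subset_signPerp_signPerp : V ⊆ signPerp (signPerp V) :=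
  fun _ hX _ hY => (hY _ hX).symm

theorem signOrthogonal_flipSigns_iff {A : Set E} :
    SignOrthogonal (flipSigns A X) Y ↔ SignOrthogonal X (flipSigns A Y) := by
  have h : ∀ e, flipSigns A X e * Y e = X e * flipSigns A Y e := fun e => by
    by_cases he : e ∈ A <;> simp [flipSigns_of_mem, flipSigns_of_notMem, he]
  simp only [SignOrthogonal, h]

theorem signPerp_preimage_flipSigns (A : Set E) :
    signPerp (flipSigns A ⁻¹' V) = flipSigns A ⁻¹' signPerp V := by
  ext Y
  constructor
  · exact fun hY X hX => signOrthogonal_flipSigns_iff.1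
      (hY _ (by rwa [Set.mem_preimage, flipSigns_flipSigns]))
  · intro hY X hX
    have h := hY _ hX
    rwa [signOrthogonal_flipSigns_iff, flipSigns_flipSigns] at h

theorem flipSigns_symmDiff (A B : Set E) (X : E → SignType) :
    flipSigns (symmDiff A B) X = flipSigns A (flipSigns B X) := by
  ext1 e
  by_cases hA : e ∈ A <;> by_cases hB : e ∈ B <;>
    simp [flipSigns, Set.mem_symmDiff, hA, hB]

end SignPerp

namespace OrientedMatroid

section Covectors

variable {E : Type*} (M : OrientedMatroid E)

/-- The covectors of `M`: the sign vectors orthogonal to all circuits. -/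
def covectors : Set (E → SignType) :=
  signPerp M.circuits

/-- The vectors of `M`: the sign vectors orthogonal to all covectors. -/
def vectors : Set (E → SignType) :=
  signPerp M.covectors

theorem covectors_reorient (A : Set E) :
    (M.reorient A).covectors = flipSigns A ⁻¹' M.covectors :=
  signPerp_preimage_flipSigns A

theorem vectors_reorient (A : Set E) :
    (M.reorient A).vectors = flipSigns A ⁻¹' M.vectors := by
  rw [vectors, covectors_reorient, signPerp_preimage_flipSigns]
  rfl

theorem exists_covector_of_blocks [Finite E] {e : E} {P N : Set E} (hB : M.Blocks e P N) :
    ∃ Y ∈ M.covectors, Y e = 1 ∧ (∀ h ∈ P, 0 ≤ Y h) ∧ ∀ h ∈ N, Y h ≤ 0 := by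
  obtain ⟨⟨P', N'⟩, ⟨hP, hN⟩, hm⟩ := Set.Finite.exists_le_maximal
    (s := {p : Set E × Set E | M.Blocks e p.1 p.2}) (Set.toFinite _) (a := (P, N)) hB
  have hm : M.MaximalBlocks e P' N' := hm
  refine ⟨paintSign P' N', fun X hX => signOrthogonal_of_forall M.neg_mem
    (fun X hX k => hm.exists_mul_paintSign_eq_neg_one hX) hX, ?_, fun h hh => ?_, fun h hh => ?_⟩
  · simp [paintSign, hm.prop.1, hm.prop.2.1]
  · have hP' := hP hh
    by_cases hN' : h ∈ N' <;> simp [paintSign, hP', hN']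
  · have hN' := hN hh
    by_cases hP' : h ∈ P' <;> simp [paintSign, hP', hN']

end Covectors

end OrientedMatroid

/-! ### Positive circuits and cocircuits -/

theorem SignsIn.nonneg {E : Type*} {P : Set E} {X : E → SignType} (h : SignsIn P ∅ X) (e : E) :
    0 ≤ X e := by
  have hX : X e ≠ -1 := fun he => h.2 e he
  generalize X e = x at *
  decide +revert

theorem SignsIn.support_subset {E : Type*} {P : Set E} {X : E → SignType} (h : SignsIn P ∅ X) :
    Function.support X ⊆ P :=
  fun e he => h.1 e (sign_eq_one_of_nonneg (h.nonneg e) he)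

theorem SignOrthogonal.mul_eq_zero_of_nonneg {E : Type*} {X Y : E → SignType}
    (h : SignOrthogonal X Y) (hX : ∀ e, 0 ≤ X e) (hY : ∀ e, 0 ≤ Y e) (e : E) : X e * Y e = 0 := by
  rcases h with h | ⟨-, f, hf⟩
  · exact h e
  · have hXf := hX f
    rw [(sign_eq_of_mul_eq_neg_one (hY f) hf).1] at hXf
    exact absurd hXf (by decide)

namespace OrientedMatroid

section Covectors

variable {E : Type*} [Finite E] {M : OrientedMatroid E} {e g : E} {X Y Z : E → SignType}

theorem exists_isPositiveCircuit_of_vector (hX : X ∈ M.vectors) (hX0 : ∀ h, 0 ≤ X h)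
    (he : X e ≠ 0) : ∃ C, M.IsPositiveCircuit C ∧ e ∈ C ∧ C ⊆ Function.support X := by
  by_contra! hc
  have hB : M.Blocks e (Function.support X) ∅ := by
    refine ⟨he, Set.notMem_empty e, fun Z hZ hZs hZe => ?_⟩
    exact hc _ ⟨Z, hZ, hZs.nonneg, rfl⟩ (by simp [hZe]) hZs.support_subset
  obtain ⟨Y, hY, hYe, hYX, -⟩ := M.exists_covector_of_blocks hB
  obtain ⟨f, hf⟩ := (hX Y hY).exists_mul_eq_neg_one (e := e)
    (by rw [hYe, sign_eq_one_of_nonneg (hX0 e) he, mul_one])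
  obtain ⟨hYf, hXf⟩ := sign_eq_of_mul_eq_neg_one (hX0 f) hf
  have := hYX f (by simp [hXf])
  rw [hYf] at this
  exact absurd this (by decide)

/-- The painting used here gives `g` both colours, so the covector it yields vanishes at `g`. -/
theorem exists_covector_eq_zero (hY : Y ∈ M.covectors) (hZ : Z ∈ M.covectors)
    (hY0 : ∀ h, 0 ≤ Y h) (hYe : Y e = 1) (hZe : 0 ≤ Z e) (hZg : Z g = -1)
    (hZY : Function.support Z ⊆ Function.support Y) :
    ∃ W ∈ M.covectors, W e = 1 ∧ W g = 0 ∧ Function.support W ⊂ Function.support Y ∧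
      ∀ h, 0 ≤ Z h → 0 ≤ W h := by
  have hYZ : ∀ h, Y h = 0 → Z h = 0 := fun h => not_imp_not.1 (@hZY h)
  have hB : M.Blocks e (insert g {h | 0 ≤ Z h}) (insert g {h | Y h = 0}) := by
    refine ⟨Or.inr hZe, ?_, fun X hX hXs hXe => ?_⟩
    · rintro (rfl | he)
      · rw [hZg] at hZe
        exact absurd hZe (by decide)
      · simp [hYe] at he
    obtain ⟨f, hf⟩ := (hY X hX).exists_mul_eq_neg_one (e := e) (by rw [hXe, hYe, mul_one])
    obtain ⟨hXf, hYf⟩ := sign_eq_of_mul_eq_neg_one (hY0 f) hf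
    obtain rfl : f = g := (hXs.2 f hXf).resolve_right (by simp [hYf])
    obtain ⟨j, hj⟩ := (hZ X hX).exists_mul_eq_neg_one (e := f) (by rw [hXf, hZg]; rfl)
    have hjf : j ≠ f := by
      rintro rfl
      simp [hXf, hZg] at hj
    rcases le_or_gt 0 (Z j) with hZj | hZj
    · obtain ⟨hXj, hZj⟩ := sign_eq_of_mul_eq_neg_one hZj hj
      simp [hYZ j ((hXs.2 j hXj).resolve_left hjf)] at hZj
    · have hXj : X j = 1 := by generalize X j = x, Z j = z at *; decide +revert
      exact hZj.not_ge ((hXs.1 j hXj).resolve_left hjf)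
  obtain ⟨W, hW, hWe, hWP, hWN⟩ := M.exists_covector_of_blocks hB
  have hWg : W g = 0 := (hWN g (Or.inl rfl)).antisymm (hWP g (Or.inl rfl))
  refine ⟨W, hW, hWe, hWg, (Set.ssubset_iff_of_subset fun h => not_imp_not.2 fun hYh => ?_).2
    ⟨g, hZY (by simp [hZg]), fun h => h hWg⟩, fun h hh => hWP h (Or.inr hh)⟩
  exact (hWN h (Or.inr hYh)).antisymm (hWP h (Or.inr (hYZ h hYh).ge))

theorem exists_covector_ssubset (hY : Y ∈ M.covectors) (hZ : Z ∈ M.covectors)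
    (hY0 : ∀ h, 0 ≤ Y h) (hYe : Y e = 1) (hZ0 : Z ≠ 0)
    (hZY : Function.support Z ⊂ Function.support Y) :
    ∃ W ∈ M.covectors, W e = 1 ∧ Function.support W ⊂ Function.support Y := by
  by_cases hZe : Z e = 0
  · obtain ⟨g, hg⟩ := Function.ne_iff.1 hZ0
    obtain ⟨V, hV, hVg, hVZ⟩ := exists_mem_signPerp_eq hZ hg (s := -1) (by decide)
    have hVe : V e = 0 := by simpa [hZe] using congrArg (e ∈ ·) hVZ
    obtain ⟨W, hW, hWe, -, hWY, -⟩ :=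
      exists_covector_eq_zero hY hV hY0 hYe hVe.ge hVg (hVZ ▸ hZY.subset)
    exact ⟨W, hW, hWe, hWY⟩
  · obtain ⟨V, hV, hVe, hVZ⟩ := exists_mem_signPerp_eq hZ hZe one_ne_zero
    exact ⟨V, hV, hVe, hVZ ▸ hZY⟩

theorem exists_nonneg_covector_ssubset (hY : Y ∈ M.covectors) (hZ : Z ∈ M.covectors)
    (hY0 : ∀ h, 0 ≤ Y h) (hYe : Y e = 1) (hZe : Z e = 1)
    (hZY : Function.support Z ⊂ Function.support Y) :
    ∃ W ∈ M.covectors, (∀ h, 0 ≤ W h) ∧ W e = 1 ∧ Function.support W ⊂ Function.support Y := by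
  obtain ⟨V, ⟨hV, hVe, hVY⟩, hmin⟩ := Set.Finite.exists_minimalFor
    (fun V : E → SignType => {h | V h < 0})
    {V | V ∈ M.covectors ∧ V e = 1 ∧ Function.support V ⊂ Function.support Y} (Set.toFinite _)
    ⟨Z, hZ, hZe, hZY⟩
  refine ⟨V, hV, fun g => ?_, hVe, hVY⟩
  by_contra! hVg
  obtain ⟨W, hW, hWe, hWg, hWY, hWV⟩ := exists_covector_eq_zero (g := g) hY hV hY0 hYe
    (by simp [hVe]) (by generalize V g = v at *; decide +revert) hVY.subset
  have hsub : {h | W h < 0} ⊆ {h | V h < 0} := fun h => by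
    simpa only [Set.mem_ofPred_eq, ← not_le] using mt (hWV h)
  exact (hmin ⟨hW, hWe, hWY⟩ hsub hVg).ne hWg

theorem exists_isPositiveCocircuit_of_covector (hY : Y ∈ M.covectors) (hY0 : ∀ h, 0 ≤ Y h)
    (he : Y e ≠ 0) : ∃ D, M.IsPositiveCocircuit D ∧ e ∈ D ∧ D ⊆ Function.support Y := by
  obtain ⟨W, ⟨hW, hW0, hWe, hWY⟩, hmin⟩ := Set.Finite.exists_minimalFor Function.support
    {W | W ∈ M.covectors ∧ (∀ h, 0 ≤ W h) ∧ W e = 1 ∧ Function.support W ⊆ Function.support Y}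
    (Set.toFinite _) ⟨Y, hY, hY0, sign_eq_one_of_nonneg (hY0 e) he, subset_rfl⟩
  refine ⟨_, ⟨W, ⟨?_, hW, fun Z hZ0 hZ hZW => ?_⟩, hW0, rfl⟩, by simp [hWe], hWY⟩
  · rintro rfl
    simp at hWe
  · by_contra hne
    obtain ⟨V, hV, hVe, hVW⟩ :=
      exists_covector_ssubset hW hZ hW0 hWe hZ0 (hZW.ssubset_of_ne hne)
    obtain ⟨U, hU, hU0, hUe, hUW⟩ := exists_nonneg_covector_ssubset hW hV hW0 hWe hVe hVW
    exact hUW.not_subset (hmin ⟨hU, hU0, hUe, hUW.subset.trans hWY⟩ hUW.subset)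

variable (M) in
theorem exists_isPositiveCircuit_or_isPositiveCocircuit (e : E) :
    (∃ C, M.IsPositiveCircuit C ∧ e ∈ C) ∨ ∃ D, M.IsPositiveCocircuit D ∧ e ∈ D := by
  by_cases hB : M.Blocks e Set.univ ∅
  · obtain ⟨Y, hY, hYe, hY0, -⟩ := M.exists_covector_of_blocks hB
    obtain ⟨D, hD, heD, -⟩ := exists_isPositiveCocircuit_of_covector hY
      (fun h => hY0 h (Set.mem_univ h)) (e := e) (by simp [hYe])
    exact Or.inr ⟨D, hD, heD⟩
  · simp only [Blocks, Set.mem_univ, Set.mem_empty_iff_false, not_false_eq_true, true_and,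
      not_forall, not_not] at hB
    obtain ⟨X, hX, hXs, hXe⟩ := hB
    exact Or.inl ⟨_, ⟨X, hX, hXs.nonneg, rfl⟩, by simp [hXe]⟩

end Covectors

end OrientedMatroid

/-! ### Partitions by least elements -/

/-- The union of the members of a family of subsets of `E` all of whose elements are `≥ a`. -/
def unionGE {E : Type*} [LinearOrder E] (𝒞 : Set (Set E)) (a : E) : Set E :=
  ⋃₀ {C | C ∈ 𝒞 ∧ ∀ e ∈ C, a ≤ e}

/-- The minima of the members of a family of subsets of `E`: the (dual-)active elements, when the
family consists of the positive circuits (cocircuits). -/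
def leastElements {E : Type*} [LinearOrder E] (𝒞 : Set (Set E)) : Set E :=
  {a | ∃ C ∈ 𝒞, IsLeast C a}

/-- The elements `e` for which `a` is the greatest possible minimum of a member containing `e`;
this is the part of the active partition with minimum `a` when `a` is a (dual-)active element. -/
def leastPart {E : Type*} [LinearOrder E] (𝒞 : Set (Set E)) (a : E) : Set E :=
  {e | IsGreatest {b | e ∈ unionGE 𝒞 b} a}

/-- The partition of `⋃₀ 𝒞` into the sets `leastPart 𝒞 a`. -/
def leastParts {E : Type*} [LinearOrder E] (𝒞 : Set (Set E)) : Set (Set E) :=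
  leastPart 𝒞 '' leastElements 𝒞

section LeastParts

variable {E : Type*} [LinearOrder E] {𝒞 𝒟 : Set (Set E)} {a e : E}

theorem antitone_unionGE (𝒞 : Set (Set E)) : Antitone (unionGE 𝒞) :=
  fun _ _ hab => Set.sUnion_subset_sUnion fun _ hC => ⟨hC.1, fun e he => hab.trans (hC.2 e he)⟩

theorem le_of_mem_unionGE (he : e ∈ unionGE 𝒞 a) : a ≤ e :=
  let ⟨_, hC, heC⟩ := he
  hC.2 e heC

theorem mem_leastElements_iff : a ∈ leastElements 𝒞 ↔ a ∈ unionGE 𝒞 a :=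
  ⟨fun ⟨C, hC, ha⟩ => ⟨C, ⟨hC, ha.2⟩, ha.1⟩, fun ⟨C, hC, ha⟩ => ⟨C, hC.1, ha, hC.2⟩⟩

theorem unionGE_eq_of_refines (h𝒞𝒟 : 𝒞 ⊆ 𝒟) (h : ∀ D ∈ 𝒟, ∀ e ∈ D, ∃ C ∈ 𝒞, e ∈ C ∧ C ⊆ D) :
    unionGE 𝒞 = unionGE 𝒟 := by
  refine funext fun a => Set.Subset.antisymm ?_ ?_
  · exact Set.sUnion_subset_sUnion fun C hC => ⟨h𝒞𝒟 hC.1, hC.2⟩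
  · rintro e ⟨D, ⟨hD, hDa⟩, he⟩
    obtain ⟨C, hC, heC, hCD⟩ := h D hD e he
    exact ⟨C, ⟨hC, fun g hg => hDa g (hCD hg)⟩, heC⟩

theorem leastPart_subset_sUnion (𝒞 : Set (Set E)) (a : E) : leastPart 𝒞 a ⊆ ⋃₀ 𝒞 :=
  fun _ ⟨⟨C, hC, heC⟩, _⟩ => ⟨C, hC.1, heC⟩

theorem mem_leastPart_self (ha : a ∈ leastElements 𝒞) : a ∈ leastPart 𝒞 a :=
  ⟨mem_leastElements_iff.1 ha, fun _ => le_of_mem_unionGE⟩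

theorem injOn_leastPart : Set.InjOn (leastPart 𝒞) (leastElements 𝒞) :=
  fun _ ha _ _ h => IsGreatest.unique (mem_leastPart_self ha) (h ▸ mem_leastPart_self ha :)

theorem pairwiseDisjoint_leastParts : (leastParts 𝒞).PairwiseDisjoint id := by
  refine Set.pairwiseDisjoint_iff.2 ?_
  rintro _ ⟨a, -, rfl⟩ _ ⟨b, -, rfl⟩ ⟨e, hea, heb⟩
  rw [IsGreatest.unique hea heb]

theorem empty_notMem_leastParts : ∅ ∉ leastParts 𝒞 := by
  rintro ⟨a, ha, h⟩
  exact Set.notMem_empty a (h ▸ mem_leastPart_self ha)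

theorem disjoint_leastParts (h : Disjoint (⋃₀ 𝒞) (⋃₀ 𝒟)) :
    Disjoint (leastParts 𝒞) (leastParts 𝒟) := by
  rw [Set.disjoint_left]
  rintro _ ⟨a, ha, rfl⟩ ⟨b, -, hb⟩
  have haa := mem_leastPart_self ha
  exact h.notMem_of_mem_left (leastPart_subset_sUnion 𝒞 a haa)
    (leastPart_subset_sUnion 𝒟 b (hb ▸ haa))

variable [Finite E]

theorem exists_mem_leastElements {C : Set E} (hC : C ∈ 𝒞) (he : e ∈ C) :
    ∃ b ∈ C, b ∈ leastElements 𝒞 ∧ e ∈ unionGE 𝒞 b := by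
  obtain ⟨b, hb, hmin⟩ := Set.exists_min_image C id (Set.toFinite C) ⟨e, he⟩
  exact ⟨b, hb, ⟨C, hC, hb, hmin⟩, C, ⟨hC, hmin⟩, he⟩

theorem mem_leastElements_of_mem_leastPart (he : e ∈ leastPart 𝒞 a) : a ∈ leastElements 𝒞 := by
  obtain ⟨⟨C, ⟨hC, hCa⟩, heC⟩, hmax⟩ := he
  obtain ⟨b, hbC, hb, heb⟩ := exists_mem_leastElements hC heC
  rwa [(hCa b hbC).antisymm (hmax heb)]

theorem exists_mem_leastPart (he : e ∈ ⋃₀ 𝒞) : ∃ a, e ∈ leastPart 𝒞 a := by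
  obtain ⟨C, hC, heC⟩ := he
  obtain ⟨b, -, -, heb⟩ := exists_mem_leastElements hC heC
  obtain ⟨a, ha, hmax⟩ := Set.exists_max_image {b | e ∈ unionGE 𝒞 b} id (Set.toFinite _) ⟨b, heb⟩
  exact ⟨a, ha, hmax⟩

theorem sUnion_eq_iUnion_unionGE (𝒞 : Set (Set E)) : ⋃₀ 𝒞 = ⋃ a, unionGE 𝒞 a := by
  refine Set.Subset.antisymm (fun e he => ?_) (Set.iUnion_subset fun a => ?_)
  · obtain ⟨a, ha, -⟩ := exists_mem_leastPart he
    exact Set.mem_iUnion.2 ⟨a, ha⟩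
  · exact Set.sUnion_subset_sUnion fun C hC => hC.1

theorem leastPart_eq_symmDiff (a : E) : leastPart 𝒞 a = unionGE 𝒞 a ∨
    ∃ b, leastPart 𝒞 a = symmDiff (unionGE 𝒞 a) (unionGE 𝒞 b) := by
  by_cases ha : IsMax a
  · exact Or.inl (Set.ext fun e => ⟨And.left, fun he => ⟨he, fun b _ => ha.isTop b⟩⟩)
  · obtain ⟨b, hab⟩ := exists_covBy_of_wellFoundedLT ha
    refine Or.inr ⟨b, ?_⟩
    rw [symmDiff_of_ge (antitone_unionGE 𝒞 hab.le)]
    refine Set.ext fun e => and_congr_right fun _ => ⟨fun hmax heb => hab.lt.not_ge (hmax heb),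
      fun heb c hec => ?_⟩
    by_contra! hac
    exact heb (antitone_unionGE 𝒞 (hab.ge_of_gt hac) hec)

theorem leastPart_eq_sdiff (a : E) :
    leastPart 𝒞 a = unionGE 𝒞 a \ ⋃ b ∈ {b ∈ leastElements 𝒞 | a < b}, unionGE 𝒞 b := by
  ext e
  simp only [Set.mem_sdiff, Set.mem_iUnion, not_exists]
  refine and_congr_right fun _ => ⟨fun hmax b hb heb => hb.2.not_ge (hmax heb), fun h c hec => ?_⟩
  by_contra! hac
  obtain ⟨C, ⟨hC, hCc⟩, heC⟩ := hec
  obtain ⟨b, hbC, hb, heb⟩ := exists_mem_leastElements hC heC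
  exact h b ⟨hb, hac.trans_le (hCc b hbC)⟩ heb

theorem isPartition_leastParts_union (h : IsCompl (⋃₀ 𝒞) (⋃₀ 𝒟)) :
    Setoid.IsPartition (leastParts 𝒞 ∪ leastParts 𝒟) := by
  refine Set.PairwiseDisjoint.isPartition_of_exists_of_ne_empty ?_ (fun e => ?_) ?_
  · refine pairwiseDisjoint_leastParts.union pairwiseDisjoint_leastParts ?_
    rintro _ ⟨a, -, rfl⟩ _ ⟨b, -, rfl⟩ -
    exact h.disjoint.mono (leastPart_subset_sUnion 𝒞 a) (leastPart_subset_sUnion 𝒟 b)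
  · rcases (h.sup_eq_top.ge (Set.mem_univ e) : e ∈ ⋃₀ 𝒞 ∪ ⋃₀ 𝒟) with he | he
    · obtain ⟨a, ha⟩ := exists_mem_leastPart he
      exact ⟨_, Or.inl ⟨a, mem_leastElements_of_mem_leastPart ha, rfl⟩, ha⟩
    · obtain ⟨a, ha⟩ := exists_mem_leastPart he
      exact ⟨_, Or.inr ⟨a, mem_leastElements_of_mem_leastPart ha, rfl⟩, ha⟩
  · exact fun h => h.elim empty_notMem_leastParts empty_notMem_leastParts

theorem ncard_leastParts_union (h : Disjoint (⋃₀ 𝒞) (⋃₀ 𝒟)) :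
    (leastParts 𝒞 ∪ leastParts 𝒟).ncard =
      (leastElements 𝒞).ncard + (leastElements 𝒟).ncard := by
  rw [Set.ncard_union_eq (disjoint_leastParts h), leastParts, leastParts,
    injOn_leastPart.ncard_image, injOn_leastPart.ncard_image]

end LeastParts

section ConsecutiveDifferences

variable {ι α : Type*}

/-- The differences `F \ G` of the consecutive members `F`, `G` of a list of sets. -/
def consecutiveDiffs (L : List (Set α)) : Set (Set α) :=
  {P | ∃ (k : ℕ) (F G : Set α), L[k]? = some F ∧ L[k + 1]? = some G ∧ P = F \ G}

variable [LinearOrder ι] {f : ι → Set α} {l : List ι}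

theorem getElem?_map_append_empty (hf : Antitone f) (hl : l.SortedLT) {k : ℕ}
    (hk : k ≤ l.length) : (l.map f ++ [∅])[k]? = some (⋃ b ∈ l.drop k, f b) := by
  rcases hk.eq_or_lt with rfl | hk
  · simp
  · rw [List.getElem?_append_left (by simpa using hk), List.getElem?_map,
      List.getElem?_eq_getElem hk, Option.map_some, Option.some_inj]
    refine Set.Subset.antisymm (Set.subset_biUnion_of_mem (u := f) ?_) (Set.iUnion₂_subset ?_)
    · exact List.mem_drop_iff_getElem.2 ⟨0, by simpa using hk, by simp⟩
    · intro b hb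
      obtain ⟨i, hi, rfl⟩ := List.mem_drop_iff_getElem.1 hb
      exact hf (hl.getElem_le_getElem_iff.2 (Nat.le_add_right k i))

theorem mem_drop_succ_iff (hl : l.SortedLT) {k : ℕ} (hk : k < l.length) {b : ι} :
    b ∈ l.drop (k + 1) ↔ b ∈ l ∧ l[k] < b := by
  constructor
  · intro hb
    obtain ⟨i, hi, rfl⟩ := List.mem_drop_iff_getElem.1 hb
    exact ⟨List.getElem_mem _, hl.getElem_lt_getElem_iff.2 (by omega)⟩
  · rintro ⟨hb, hkb⟩
    obtain ⟨i, hi, rfl⟩ := List.mem_iff_getElem.1 hb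
    have hki : k < i := hl.getElem_lt_getElem_iff.1 hkb
    exact List.mem_drop_iff_getElem.2 ⟨i - (k + 1), by omega, by congr 1; omega⟩

theorem consecutiveDiffs_map_append_empty (hf : Antitone f) (hl : l.SortedLT) :
    consecutiveDiffs (l.map f ++ [∅]) =
      (fun a => f a \ ⋃ b ∈ {b | b ∈ l ∧ a < b}, f b) '' {a | a ∈ l} := by
  have hdiff : ∀ {k} (hk : k < l.length), (⋃ b ∈ l.drop (k + 1), f b) =
      ⋃ b ∈ {b | b ∈ l ∧ l[k] < b}, f b := fun hk => by
    simp only [mem_drop_succ_iff hl hk, Set.mem_ofPred_eq]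
  have hhead : ∀ {k} (hk : k < l.length), (l.map f ++ [∅])[k]? = some (f l[k]) := fun hk => by
    simp [List.getElem?_append_left, hk]
  ext P
  constructor
  · rintro ⟨k, F, G, hF, hG, rfl⟩
    have hk : k < l.length := by
      simpa using (List.getElem?_eq_some_iff.1 hG).1
    rw [hhead hk, Option.some_inj] at hF
    rw [getElem?_map_append_empty hf hl hk, Option.some_inj, hdiff hk] at hG
    exact ⟨l[k], List.getElem_mem hk, by rw [← hF, ← hG]⟩
  · rintro ⟨a, ha, rfl⟩
    obtain ⟨k, hk, rfl⟩ := List.mem_iff_getElem.1 ha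
    exact ⟨k, _, _, hhead hk, getElem?_map_append_empty hf hl hk, by rw [hdiff hk]⟩

end ConsecutiveDifferences

section Partition

variable {α : Type*} {c : Set (Set α)}

theorem sUnion_symmDiff_of_isPartition (hc : Setoid.IsPartition c) {S T : Set (Set α)}
    (hS : S ⊆ c) (hT : T ⊆ c) : ⋃₀ symmDiff S T = symmDiff (⋃₀ S) (⋃₀ T) := by
  have sdiff : ∀ {S T : Set (Set α)}, S ⊆ c → T ⊆ c → ⋃₀ (S \ T) = ⋃₀ S \ ⋃₀ T := by
    intro S T hS hT
    simp only [Set.sUnion_eq_biUnion]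
    exact (Set.biUnion_sdiff_biUnion_eq (f := id)
      (hc.pairwiseDisjoint.subset (Set.union_subset hS hT))).symm
  rw [Set.symmDiff_def, Set.sUnion_union, sdiff hS hT, sdiff hT hS, Set.symmDiff_def]

theorem injOn_sUnion_of_isPartition (hc : Setoid.IsPartition c) :
    Set.InjOn Set.sUnion (𝒫 c) := by
  have key : ∀ S ⊆ c, ∀ T ⊆ c, ⋃₀ S = ⋃₀ T → S ⊆ T := fun S hS T hT h => by
    rw [Set.sUnion_eq_biUnion, Set.sUnion_eq_biUnion] at h
    exact (hc.pairwiseDisjoint.subset (Set.union_subset hS hT)).subset_of_biUnion_subset_biUnion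
      (fun P hP => Setoid.nonempty_of_mem_partition hc (hS hP)) h.subset
  exact fun S hS T hT h => (key S hS T hT h).antisymm (key T hT S hS h.symm)

end Partition

/-! ### Sign reversal on unions of positive supports -/

section PositiveSupports

variable {E : Type*} {V W S : Set (E → SignType)} {U C : Set E} {X : E → SignType}

theorem flipSigns_eq_self (h : Disjoint U (Function.support X)) : flipSigns U X = X := by
  ext1 e
  by_cases he : e ∈ U
  · have hXe : X e = 0 := Function.notMem_support.1 (h.notMem_of_mem_left he)
    rw [flipSigns_of_mem he, hXe, neg_zero]
  · exact flipSigns_of_notMem he X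

theorem flipSigns_eq_neg (h : Function.support X ⊆ U) : flipSigns U X = -X := by
  ext1 e
  by_cases he : e ∈ U
  · exact flipSigns_of_mem he X
  · have hXe : X e = 0 := Function.notMem_support.1 (Set.notMem_subset h he)
    rw [flipSigns_of_notMem he, Pi.neg_apply, hXe, neg_zero]

theorem preimage_flipSigns_preimage_flipSigns (U : Set E) (V : Set (E → SignType)) :
    flipSigns U ⁻¹' (flipSigns U ⁻¹' V) = V := by
  ext X
  simp only [Set.mem_preimage, flipSigns_flipSigns]

theorem disjoint_of_mem_positiveSupports (hWV : W ⊆ signPerp V) {C D : Set E}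
    (hC : C ∈ positiveSupports V) (hD : D ∈ positiveSupports W) : Disjoint C D := by
  obtain ⟨X, hX, hX0, rfl⟩ := hC
  obtain ⟨Y, hY, hY0, rfl⟩ := hD
  refine Set.disjoint_left.2 fun e hXe hYe => ?_
  exact mul_ne_zero hXe hYe ((hWV hY X hX).mul_eq_zero_of_nonneg hX0 hY0 e)

theorem union_mem_positiveSupports {C D : Set E} (hC : C ∈ positiveSupports (signPerp S))
    (hD : D ∈ positiveSupports (signPerp S)) : C ∪ D ∈ positiveSupports (signPerp S) := by
  obtain ⟨X, hX, hX0, rfl⟩ := hC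
  obtain ⟨Y, hY, hY0, rfl⟩ := hD
  refine ⟨signComp X Y, signComp_mem_signPerp hX hY, fun e => ?_, support_signComp⟩
  by_cases he : X e = 0
  · simpa [signComp, he] using hY0 e
  · simpa [signComp, he] using hX0 e

theorem mem_positiveSupports_preimage_flipSigns (hneg : ∀ X ∈ V, -X ∈ V) (hCU : C ⊆ U)
    (hC : C ∈ positiveSupports V) : C ∈ positiveSupports (flipSigns U ⁻¹' V) := by
  obtain ⟨X, hX, hX0, rfl⟩ := hC
  refine ⟨X, ?_, hX0, rfl⟩
  rw [Set.mem_preimage, flipSigns_eq_neg hCU]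
  exact hneg X hX

theorem positiveSupports_subset_preimage_flipSigns (hWV : W ⊆ signPerp V)
    (hU : U ∈ positiveSupports V) :
    positiveSupports W ⊆ positiveSupports (flipSigns U ⁻¹' W) := by
  intro D hD
  have hUD := disjoint_of_mem_positiveSupports hWV hU hD
  obtain ⟨Y, hY, hY0, rfl⟩ := hD
  exact ⟨Y, by rwa [Set.mem_preimage, flipSigns_eq_self hUD], hY0, rfl⟩

theorem positiveSupports_preimage_flipSigns (hneg : ∀ X ∈ V, -X ∈ V) (hWV : W ⊆ signPerp V)
    (hU : U ∈ positiveSupports V) :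
    positiveSupports (flipSigns U ⁻¹' W) = positiveSupports W := by
  refine Set.Subset.antisymm ?_ (positiveSupports_subset_preimage_flipSigns hWV hU)
  have h := positiveSupports_subset_preimage_flipSigns (W := flipSigns U ⁻¹' W)
    (V := flipSigns U ⁻¹' V) (signPerp_preimage_flipSigns U ▸ Set.preimage_mono hWV)
    (mem_positiveSupports_preimage_flipSigns hneg subset_rfl hU)
  rwa [preimage_flipSigns_preimage_flipSigns] at h

theorem union_mem_positiveSupports_of_flipSigns (hU : U ∈ positiveSupports (signPerp S))
    (hC : C ∈ positiveSupports (flipSigns U ⁻¹' signPerp S)) :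
    U ∪ C ∈ positiveSupports (signPerp S) := by
  obtain ⟨X, hX, hX0, rfl⟩ := hU
  obtain ⟨Y, hY, hY0, rfl⟩ := hC
  refine ⟨_, signComp_mem_signPerp hX hY, fun e => ?_, by rw [support_signComp, support_flipSigns]⟩
  by_cases he : X e = 0
  · have heU : e ∉ Function.support X := Function.notMem_support.2 he
    simpa [signComp, he, flipSigns_of_notMem heU] using hY0 e
  · simpa [signComp, he] using hX0 e

variable [LinearOrder E] [Finite E]

theorem unionGE_mem_positiveSupports (S : Set (E → SignType)) (a : E) :
    unionGE (positiveSupports (signPerp S)) a ∈ positiveSupports (signPerp S) := by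
  have hsup : SupClosed (positiveSupports (signPerp S)) :=
    fun _ hC _ hD => union_mem_positiveSupports hC hD
  exact hsup.sSup_mem (Set.toFinite _)
    ⟨0, zero_mem_signPerp, fun _ => le_rfl, Function.support_zero⟩ fun _ hC => hC.1

theorem unionGE_preimage_flipSigns_subset (S : Set (E → SignType)) (a b : E) :
    unionGE (positiveSupports
      (flipSigns (unionGE (positiveSupports (signPerp S)) a) ⁻¹' signPerp S)) b ⊆
        unionGE (positiveSupports (signPerp S)) b := by
  set U := unionGE (positiveSupports (signPerp S)) a
  have hUV := unionGE_mem_positiveSupports S a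
  refine Set.sUnion_subset fun C ⟨hC, hCb⟩ => ?_
  have hUC := union_mem_positiveSupports_of_flipSigns hUV hC
  rcases le_total b a with hba | hab
  · refine Set.subset_union_right.trans (Set.subset_sUnion_of_mem ⟨hUC, ?_⟩)
    rintro e (he | he)
    · exact hba.trans (le_of_mem_unionGE he)
    · exact hCb e he
  · have hCU : C ⊆ U := by
      refine Set.subset_union_right.trans (Set.subset_sUnion_of_mem ⟨hUC, ?_⟩)
      rintro e (he | he)
      · exact le_of_mem_unionGE he
      · exact hab.trans (hCb e he)
    have hneg : ∀ X ∈ flipSigns U ⁻¹' signPerp S, -X ∈ flipSigns U ⁻¹' signPerp S :=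
      fun X hX => by
        rw [Set.mem_preimage, flipSigns_neg]
        exact neg_mem_signPerp hX
    have hCV := mem_positiveSupports_preimage_flipSigns hneg hCU hC
    rw [preimage_flipSigns_preimage_flipSigns] at hCV
    exact Set.subset_sUnion_of_mem ⟨hCV, hCb⟩

theorem unionGE_preimage_flipSigns (S : Set (E → SignType)) (a : E) :
    unionGE (positiveSupports
      (flipSigns (unionGE (positiveSupports (signPerp S)) a) ⁻¹' signPerp S)) =
        unionGE (positiveSupports (signPerp S)) := by
  set U := unionGE (positiveSupports (signPerp S)) a
  refine funext fun b => (unionGE_preimage_flipSigns_subset S a b).antisymm ?_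
  have hUa : unionGE (positiveSupports (signPerp (flipSigns U ⁻¹' S))) a = U := by
    rw [signPerp_preimage_flipSigns]
    refine (unionGE_preimage_flipSigns_subset S a a).antisymm (Set.subset_sUnion_of_mem ⟨?_, ?_⟩)
    · exact mem_positiveSupports_preimage_flipSigns (fun X hX => neg_mem_signPerp hX) subset_rfl
        (unionGE_mem_positiveSupports S a)
    · exact fun e he => le_of_mem_unionGE he
  have h := unionGE_preimage_flipSigns_subset (flipSigns U ⁻¹' S) a b
  rwa [hUa, signPerp_preimage_flipSigns, preimage_flipSigns_preimage_flipSigns] at h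

end PositiveSupports

/-! ### Activity classes -/

theorem consecutiveDiffs_sortedElements {E : Type*} [Fintype E] [LinearOrder E]
    (𝒞 : Set (Set E)) :
    consecutiveDiffs ((sortedElements (leastElements 𝒞)).map (unionGE 𝒞) ++ [∅]) =
      leastParts 𝒞 := by
  have hsorted : (sortedElements (leastElements 𝒞)).SortedLT := Finset.sortedLT_sort _
  have hmem : ∀ a, a ∈ sortedElements (leastElements 𝒞) ↔ a ∈ leastElements 𝒞 := fun a => by
    simp [sortedElements]
  rw [consecutiveDiffs_map_append_empty (antitone_unionGE 𝒞) hsorted]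
  simp only [hmem, leastParts, leastPart_eq_sdiff, Set.ofPred_mem_eq]

namespace OrientedMatroid

theorem reorient_reorient {E : Type*} (M : OrientedMatroid E) (A B : Set E) :
    (M.reorient A).reorient B = M.reorient (symmDiff A B) := by
  have hflip : {X | flipSigns A (flipSigns B X) ∈ M.circuits} =
      {X | flipSigns (symmDiff A B) X ∈ M.circuits} := by
    simp only [flipSigns_symmDiff]
  simp only [reorient, Set.mem_ofPred_eq, hflip]

theorem reorient_empty {E : Type*} (M : OrientedMatroid E) : M.reorient ∅ = M := by
  have hflip : {X | flipSigns ∅ X ∈ M.circuits} = M.circuits :=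
    Set.ext fun X => by rw [Set.mem_ofPred_eq, flipSigns_eq_self (Set.empty_disjoint _)]
  simp only [reorient, hflip]

theorem isCompl_sUnion_positiveSupports {E : Type*} [Finite E] (M : OrientedMatroid E) :
    IsCompl (⋃₀ positiveSupports M.circuits) (⋃₀ positiveSupports M.cocircuits) := by
  refine ⟨?_, codisjoint_iff.2 (Set.eq_univ_of_forall fun e => ?_)⟩
  · refine Set.disjoint_sUnion_left.2 fun C hC => Set.disjoint_sUnion_right.2 fun D hD => ?_
    exact disjoint_of_mem_positiveSupports (fun Y hY => hY.2.1) hC hD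
  · rcases M.exists_isPositiveCircuit_or_isPositiveCocircuit e with ⟨C, hC, he⟩ | ⟨D, hD, he⟩
    · exact Or.inl ⟨C, hC, he⟩
    · exact Or.inr ⟨D, hD, he⟩

section ActivityEquivalence

variable {E : Type*} [LinearOrder E] {L M N : OrientedMatroid E}

theorem circuitUnionGE_eq [Finite E] (M : OrientedMatroid E) :
    M.circuitUnionGE = unionGE (positiveSupports M.vectors) := by
  refine unionGE_eq_of_refines (𝒞 := positiveSupports M.circuits) ?_ ?_
  · exact fun C ⟨X, hX, hC⟩ => ⟨X, subset_signPerp_signPerp hX, hC⟩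
  · rintro _ ⟨X, hX, hX0, rfl⟩ e he
    exact exists_isPositiveCircuit_of_vector hX hX0 he

theorem cocircuitUnionGE_eq [Finite E] (M : OrientedMatroid E) :
    M.cocircuitUnionGE = unionGE (positiveSupports M.covectors) := by
  refine unionGE_eq_of_refines (𝒞 := positiveSupports M.cocircuits) ?_ ?_
  · exact fun C ⟨Y, hY, hC⟩ => ⟨Y, hY.2.1, hC⟩
  · rintro _ ⟨Y, hY, hY0, rfl⟩ e he
    exact exists_isPositiveCocircuit_of_covector hY hY0 he

/-- Two oriented matroids on the same ordered set are activity equivalent if the positive circuits,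
and the positive cocircuits, with minimum at least `a` have the same union in both, for every `a`.
This determines the active filtration. -/
def ActivityEquivalent (M N : OrientedMatroid E) : Prop :=
  M.circuitUnionGE = N.circuitUnionGE ∧ M.cocircuitUnionGE = N.cocircuitUnionGE

theorem ActivityEquivalent.trans (hLM : L.ActivityEquivalent M) (hMN : M.ActivityEquivalent N) :
    L.ActivityEquivalent N :=
  ⟨hLM.1.trans hMN.1, hLM.2.trans hMN.2⟩

theorem ActivityEquivalent.activeElements_eq (h : M.ActivityEquivalent N) :
    M.activeElements = N.activeElements := by
  have hmem : ∀ (M : OrientedMatroid E) a, a ∈ M.activeElements ↔ a ∈ M.circuitUnionGE a :=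
    fun _ _ => mem_leastElements_iff
  exact Set.ext fun a => by rw [hmem, hmem, h.1]

theorem ActivityEquivalent.dualActiveElements_eq (h : M.ActivityEquivalent N) :
    M.dualActiveElements = N.dualActiveElements := by
  have hmem : ∀ (M : OrientedMatroid E) a, a ∈ M.dualActiveElements ↔ a ∈ M.cocircuitUnionGE a :=
    fun _ _ => mem_leastElements_iff
  exact Set.ext fun a => by rw [hmem, hmem, h.2]

theorem ActivityEquivalent.activeFiltration_eq [Fintype E] (h : M.ActivityEquivalent N) :
    M.activeFiltration = N.activeFiltration := by
  have hcyclic : ∀ M : OrientedMatroid E,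
      ⋃₀ {C | M.IsPositiveCircuit C} = ⋃ a, M.circuitUnionGE a :=
    fun M => sUnion_eq_iUnion_unionGE (positiveSupports M.circuits)
  ext1
  · simp only [activeFiltration, h.activeElements_eq, h.1]
  · simp only [activeFiltration, hcyclic, h.1]
  · simp only [activeFiltration, h.dualActiveElements_eq, h.2]

theorem ActivityEquivalent.activePartition_eq [Fintype E] (h : M.ActivityEquivalent N) :
    M.activePartition = N.activePartition := by
  simp only [activePartition, h.activeFiltration_eq]

variable [Finite E]

theorem activityEquivalent_reorient_circuitUnionGE (M : OrientedMatroid E) (a : E) :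
    (M.reorient (M.circuitUnionGE a)).ActivityEquivalent M := by
  simp only [ActivityEquivalent, circuitUnionGE_eq, cocircuitUnionGE_eq, vectors_reorient,
    covectors_reorient]
  refine ⟨unionGE_preimage_flipSigns M.covectors a, congrArg unionGE ?_⟩
  exact positiveSupports_preimage_flipSigns (fun _ => neg_mem_signPerp) subset_signPerp_signPerp
    (unionGE_mem_positiveSupports M.covectors a)

theorem activityEquivalent_reorient_cocircuitUnionGE (M : OrientedMatroid E) (a : E) :
    (M.reorient (M.cocircuitUnionGE a)).ActivityEquivalent M := by
  simp only [ActivityEquivalent, circuitUnionGE_eq, cocircuitUnionGE_eq, vectors_reorient,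
    covectors_reorient]
  refine ⟨congrArg unionGE ?_, unionGE_preimage_flipSigns M.circuits a⟩
  exact positiveSupports_preimage_flipSigns (fun _ => neg_mem_signPerp) subset_rfl
    (unionGE_mem_positiveSupports M.circuits a)

theorem ActivityEquivalent.reorient_symmDiff_circuitUnionGE {A : Set E}
    (h : (M.reorient A).ActivityEquivalent M) (a : E) :
    (M.reorient (symmDiff A (M.circuitUnionGE a))).ActivityEquivalent M := by
  rw [← reorient_reorient, ← h.1]
  exact (activityEquivalent_reorient_circuitUnionGE _ a).trans h

theorem ActivityEquivalent.reorient_symmDiff_cocircuitUnionGE {A : Set E}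
    (h : (M.reorient A).ActivityEquivalent M) (a : E) :
    (M.reorient (symmDiff A (M.cocircuitUnionGE a))).ActivityEquivalent M := by
  rw [← reorient_reorient, ← h.2]
  exact (activityEquivalent_reorient_cocircuitUnionGE _ a).trans h

end ActivityEquivalence

section ActivePartition

variable {E : Type*} [Fintype E] [LinearOrder E]

theorem activePartition_eq_leastParts_union (M : OrientedMatroid E) : M.activePartition =
    leastParts (positiveSupports M.circuits) ∪ leastParts (positiveSupports M.cocircuits) := by
  rw [← consecutiveDiffs_sortedElements, ← consecutiveDiffs_sortedElements]
  have hupper : M.activeFiltration.upper =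
      ((sortedElements M.dualActiveElements).map M.cocircuitUnionGE ++ [∅]).map compl := by
    simp [activeFiltration, Function.comp_def]
  have hcompl : ∀ F G : Set E, Gᶜ \ Fᶜ = F \ G := fun F G => by
    rw [Set.sdiff_eq, compl_compl, Set.inter_comm, Set.sdiff_eq]
  refine Set.ext fun P => or_congr Iff.rfl ?_
  simp only [hupper, List.getElem?_map, Option.map_eq_some_iff]
  constructor
  · rintro ⟨k, _, _, ⟨F, hF, rfl⟩, ⟨G, hG, rfl⟩, rfl⟩
    exact ⟨k, F, G, hF, hG, hcompl F G⟩
  · rintro ⟨k, F, G, hF, hG, rfl⟩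
    exact ⟨k, _, _, ⟨F, hF, rfl⟩, ⟨G, hG, rfl⟩, (hcompl F G).symm⟩

theorem isPartition_activePartition (M : OrientedMatroid E) :
    Setoid.IsPartition M.activePartition :=
  M.activePartition_eq_leastParts_union ▸
    isPartition_leastParts_union M.isCompl_sUnion_positiveSupports

theorem ncard_activePartition (M : OrientedMatroid E) :
    M.activePartition.ncard = M.dualActiveElements.ncard + M.activeElements.ncard := by
  rw [activePartition_eq_leastParts_union, add_comm,
    ncard_leastParts_union M.isCompl_sUnion_positiveSupports.disjoint]
  rfl

theorem ncard_activeUnions (M : OrientedMatroid E) :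
    M.activeUnions.ncard = 2 ^ (M.dualActiveElements.ncard + M.activeElements.ncard) := by
  have himage : M.activeUnions = Set.sUnion '' 𝒫 M.activePartition :=
    Set.ext fun A => exists_congr fun S => and_congr_right fun _ => eq_comm
  rw [himage, (injOn_sUnion_of_isPartition M.isPartition_activePartition).ncard_image,
    Set.ncard_powerset, ncard_activePartition]

theorem symmDiff_mem_activeUnions {M : OrientedMatroid E} {A B : Set E} (hA : A ∈ M.activeUnions)
    (hB : B ∈ M.activeUnions) : symmDiff A B ∈ M.activeUnions := by
  obtain ⟨S, hS, rfl⟩ := hA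
  obtain ⟨T, hT, rfl⟩ := hB
  exact ⟨symmDiff S T, symmDiff_le_sup.trans (Set.union_subset hS hT),
    (sUnion_symmDiff_of_isPartition M.isPartition_activePartition hS hT).symm⟩

theorem ActivityEquivalent.reorient_symmDiff_of_mem_activePartition {M : OrientedMatroid E}
    {A P : Set E} (h : (M.reorient A).ActivityEquivalent M) (hP : P ∈ M.activePartition) :
    (M.reorient (symmDiff A P)).ActivityEquivalent M := by
  rw [activePartition_eq_leastParts_union] at hP
  rcases hP with ⟨a, -, rfl⟩ | ⟨a, -, rfl⟩
  · have ha := h.reorient_symmDiff_circuitUnionGE a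
    rcases leastPart_eq_symmDiff a with hP | ⟨b, hP⟩
    · rwa [hP]
    · rw [hP, ← symmDiff_assoc]
      exact ha.reorient_symmDiff_circuitUnionGE b
  · have ha := h.reorient_symmDiff_cocircuitUnionGE a
    rcases leastPart_eq_symmDiff a with hP | ⟨b, hP⟩
    · rwa [hP]
    · rw [hP, ← symmDiff_assoc]
      exact ha.reorient_symmDiff_cocircuitUnionGE b

theorem activityEquivalent_reorient_of_mem_activeUnions {M : OrientedMatroid E} {A : Set E}
    (hA : A ∈ M.activeUnions) : (M.reorient A).ActivityEquivalent M := by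
  obtain ⟨S, hS, rfl⟩ := hA
  induction S, Set.toFinite S using Set.Finite.induction_on with
  | empty =>
    rw [Set.sUnion_empty, reorient_empty]
    exact ⟨rfl, rfl⟩
  | @insert P S hPS _ ih =>
    obtain ⟨hP, hSM⟩ := Set.insert_subset_iff.1 hS
    have hinsert : insert P S = symmDiff S {P} := by
      rw [(Set.disjoint_singleton_right.2 hPS).symmDiff_eq_sup]
      exact Set.union_singleton.symm
    rw [hinsert, sUnion_symmDiff_of_isPartition M.isPartition_activePartition hSM
      (Set.singleton_subset_iff.2 hP), Set.sUnion_singleton]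
    exact (ih hSM).reorient_symmDiff_of_mem_activePartition hP

theorem mem_activityClass_self (M : OrientedMatroid E) (A : Set E) : A ∈ M.activityClass A :=
  ⟨∅, ⟨∅, Set.empty_subset _, Set.sUnion_empty.symm⟩, (symmDiff_bot A).symm⟩

theorem activityClass_eq_of_mem {M : OrientedMatroid E} {A A' : Set E}
    (h : A' ∈ M.activityClass A) : M.activityClass A' = M.activityClass A := by
  obtain ⟨B, hB, rfl⟩ := h
  have hU : (M.reorient (symmDiff A B)).activeUnions = (M.reorient A).activeUnions := by
    rw [← reorient_reorient, activeUnions, activeUnions,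
      (activityEquivalent_reorient_of_mem_activeUnions hB).activePartition_eq]
  ext A'
  constructor
  · rintro ⟨B', hB', rfl⟩
    exact ⟨symmDiff B B', symmDiff_mem_activeUnions hB (hU ▸ hB'), symmDiff_assoc A B B'⟩
  · rintro ⟨B', hB', rfl⟩
    refine ⟨symmDiff B B', hU ▸ symmDiff_mem_activeUnions hB hB', ?_⟩
    rw [symmDiff_assoc, symmDiff_symmDiff_cancel_left]

theorem isPartition_activityClass (M : OrientedMatroid E) :
    Setoid.IsPartition (Set.range M.activityClass) := by
  refine ⟨?_, fun A => ⟨_, ⟨⟨A, rfl⟩, M.mem_activityClass_self A⟩, ?_⟩⟩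
  · rintro ⟨A, hA⟩
    exact Set.notMem_empty A (hA ▸ M.mem_activityClass_self A)
  · rintro _ ⟨⟨A', rfl⟩, hA⟩
    exact (activityClass_eq_of_mem hA).symm

end ActivePartition

end OrientedMatroid

theorem proposition4p8 {E : Type*} [Fintype E] [LinearOrder E] (M : OrientedMatroid E) :
    -- the parts of the active partition of `M` do partition `E`
    Setoid.IsPartition M.activePartition ∧
    -- there are `2 ^ (ι + ε)` reorientations obtained by reorienting unions of parts
    M.activeUnions.ncard = 2 ^ (M.dualActiveElements.ncard + M.activeElements.ncard) ∧
    -- all of them have the same active filtration, partition and (dual-)active elements as `M`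
    (∀ A ∈ M.activeUnions,
      (M.reorient A).activeFiltration = M.activeFiltration ∧
      (M.reorient A).activePartition = M.activePartition ∧
      (M.reorient A).activeElements = M.activeElements ∧
      (M.reorient A).dualActiveElements = M.dualActiveElements) ∧
    -- the activity classes partition the set of reorientations of `M`
    Setoid.IsPartition (Set.range fun A : Set E => M.activityClass A) := by
  refine ⟨M.isPartition_activePartition, M.ncard_activeUnions, fun A hA => ?_,
    M.isPartition_activityClass⟩
  have h := OrientedMatroid.activityEquivalent_reorient_of_mem_activeUnions hA
  exact ⟨h.activeFiltration_eq, h.activePartition_eq, h.activeElements_eq,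
    h.dualActiveElements_eq⟩
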